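/- **Theorem 4.2 (flip/flop formula).** Let $(X,\|\cdot\|)$ be a smooth, strictly convex normed plane (a two-dimensional real normed space whose norm is differentiable away from the origin and whose unit circle $S$ contains no segment), with a fixed nondegenerate alternating bilinear form $[\cdot,\cdot]$. Write $x\dashv_B y$ if $\|x+ty\|\ge\|x\|$ for all $t\in\mathbb R$, and for $v\ne 0$ let $b(v)\in S$ be the unique unit vector with $v\dashv_B b(v)$ and $[v,b(v)]>0$. Let $\gamma:S^1=\mathbb R/\mathbb Z\to X$ be a closed front with normal field $\eta:S^1\to S$, that is, $\gamma,\eta$ are $C^\infty$, $\eta(t)\dashv_B\gamma'(t)$ for all $t$, and $\gamma',\eta'$ never vanish simultaneously. Let $(\alpha,\kappa)$ be its curvature pair, defined by $\gamma'=\alpha\,\xi$ and $\eta'=\kappa\,\xi$ with $\xi=b\circ\eta$. Assume that $\gamma$ is generic: every singular point ($\gamma'(t_0)=0$) is an ordinary cusp ($\gamma''(t_0),\gamma'''(t_0)$ are linearly independent), and $\eta(t_0),\eta(t_1)$ are linearly independent whenever $t_0\ne t_1$ and $\gamma(t_0)=\gamma(t_1)$. A function $f$ crosses zero at $t_0$ upward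 (downward) if $f(t_0)=0$ and $f$ is negative (positive) just before $t_0$ and positive (negative) just after $t_0$. An *inflection point* is a zero-crossing of $\kappa$; it is a *flip* if $\alpha\kappa$ crosses zero upward at it, and a *flop* if $\alpha\kappa$ crosses zero downward at it. Assume that there are only finitely many inflection points on $S^1$ and that $\kappa$ changes sign only at inflection points: if $s<t$ and $\kappa(s)\kappa(t)<0$ (with $\kappa$ regarded as a $1$-periodic function on $\mathbb R$), then some inflection point lies strictly between $s$ and $t$. (Both hold, for instance, if $\kappa$ has only finitely many zeros on $S^1$.) A cusp $t_0$ is a *zig* if $[\eta(t_0),\eta'(t_0)]>0$ and a *zag* if $[\eta(t_0),\eta'(t_0)]<0$. Listing the cusps in increasing order in $[0,1)$ and writing $a$ for a zig and $b$ for a zag gives a word $w_\gamma$ in $\mathbb Z_2*\mathbb Z_2=\langle a,b\mid a^2=b^2=1\rangle$; the *Maslov index* $z(\gamma)$ is the number $k\ge 0$ with $w_\gamma=(ab)^k$ or $w_\gamma=(ba)^k$. Let $k_\gamma=[\alpha:\kappa]:S^1\to \mathrm P^1(\mathbb R)$, where $\mathrm P^1(\mathbb R)$ is oriented so that the coordinate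 $y/x$ of $[x:y]$ increases. Then there are finitely many cusps, $z(\gamma)$ is well defined (such a $k$ exists and is unique), every inflection point is either a flip or a flop and not both, the map $k_\gamma$ has a well-defined degree and $\deg k_\gamma=\#\mathrm{flip}-\#\mathrm{flop}$, and $$z(\gamma)=\tfrac12\,\bigl|\#\mathrm{flip}-\#\mathrm{flop}\bigr|.$$ -/

import Mathlib

open scoped ContDiff Topology

/-! Normed planes -/

/-- Birkhoff orthogonality `x ⊣ y`: `‖x + t y‖ ≥ ‖x‖` for every real `t`. -/
def BirkhoffOrthogonal {X : Type*} [NormedAddCommGroup X] [NormedSpace ℝ X] (x y : X) : Prop :=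
  ∀ t : ℝ, ‖x‖ ≤ ‖x + t • y‖

/-- Smoothness of the normed plane: the norm is differentiable away from the origin
(the unit circle has a unique supporting line at each of its points, hence is a `C¹` curve).
This is implied by any stronger regularity of the unit circle, such as `C^∞`. -/
def IsSmoothNorm (X : Type*) [NormedAddCommGroup X] [NormedSpace ℝ X] : Prop :=
  ∀ x : X, x ≠ 0 → DifferentiableAt ℝ (fun y : X => ‖y‖) x

/-- The map `b`: for `v ≠ 0`, `tangentDir σ v` is the unique unit vector `w` with `v ⊣ w` and
`[v, w] > 0`, where `[·,·] = σ` (see `existsUnique_tangentDir`). -/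
noncomputable def tangentDir {X : Type*} [NormedAddCommGroup X] [NormedSpace ℝ X]
    (σ : LinearMap.BilinForm ℝ X) (v : X) : X :=
  Classical.epsilon fun w : X => ‖w‖ = 1 ∧ BirkhoffOrthogonal v w ∧ 0 < σ v w

/-! Legendre curves -/

/-- `(γ, η) : ℝ → X × S` is a (smooth) Legendre curve, `S` being the unit circle of `X`. -/
structure IsLegendreCurve {X : Type*} [NormedAddCommGroup X] [NormedSpace ℝ X]
    (γ η : ℝ → X) : Prop where
  smooth_curve : ContDiff ℝ ∞ γ
  smooth_normal : ContDiff ℝ ∞ η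
  norm_normal : ∀ t, ‖η t‖ = 1
  orthogonal : ∀ t, BirkhoffOrthogonal (η t) (deriv γ t)

/-- A Legendre immersion: the derivatives of `γ` and `η` never vanish simultaneously.
The curve `γ` is then a front. -/
structure IsLegendreImmersion {X : Type*} [NormedAddCommGroup X] [NormedSpace ℝ X]
    (γ η : ℝ → X) : Prop extends IsLegendreCurve γ η where
  immersion : ∀ t, deriv γ t ≠ 0 ∨ deriv η t ≠ 0

/-- A closed front `γ : S¹ → X` with normal field `η : S¹ → S`, where `S¹ = ℝ/ℤ`. Maps on `S¹` are
given as `1`-periodic maps on `ℝ`, and points of `S¹` by their representatives in `[0, 1)`. -/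
structure IsClosedFront {X : Type*} [NormedAddCommGroup X] [NormedSpace ℝ X]
    (γ η : ℝ → X) : Prop extends IsLegendreImmersion γ η where
  periodic_curve : Function.Periodic γ 1
  periodic_normal : Function.Periodic η 1

/-- The first curvature function: the coefficient `α` in `γ' = α ξ`, with `ξ = b ∘ η`
(see `deriv_curve_eq`). -/
noncomputable def curvAlpha {X : Type*} [NormedAddCommGroup X] [NormedSpace ℝ X]
    (σ : LinearMap.BilinForm ℝ X) (γ η : ℝ → X) (t : ℝ) : ℝ :=
  σ (η t) (deriv γ t) / σ (η t) (tangentDir σ (η t))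

/-- The second curvature function: the coefficient `κ` in `η' = κ ξ`, with `ξ = b ∘ η`
(see `deriv_normal_eq`). -/
noncomputable def curvKappa {X : Type*} [NormedAddCommGroup X] [NormedSpace ℝ X]
    (σ : LinearMap.BilinForm ℝ X) (η : ℝ → X) (t : ℝ) : ℝ :=
  σ (η t) (deriv η t) / σ (η t) (tangentDir σ (η t))

/-! Ordinary cusps and generic fronts -/

/-- A singular point of `γ` at which `γ''` and `γ'''` are linearly independent. -/
def IsOrdinaryCusp {X : Type*} [NormedAddCommGroup X] [NormedSpace ℝ X]
    (γ : ℝ → X) (t : ℝ) : Prop :=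
  deriv γ t = 0 ∧ LinearIndependent ℝ ![iteratedDeriv 2 γ t, iteratedDeriv 3 γ t]

/-- All singular points are ordinary cusps, and all self-intersections are double points. -/
structure IsGenericFront {X : Type*} [NormedAddCommGroup X] [NormedSpace ℝ X]
    (γ η : ℝ → X) : Prop where
  singular_cusp : ∀ t, deriv γ t = 0 → IsOrdinaryCusp γ t
  double_points : ∀ s ∈ Set.Ico (0 : ℝ) 1, ∀ t ∈ Set.Ico (0 : ℝ) 1,
    s ≠ t → γ s = γ t → LinearIndependent ℝ ![η s, η t]

/-! The Maslov index (zigzag number) -/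

/-- The free product `ℤ₂ * ℤ₂`. -/
abbrev FreeProdZ2 : Type :=
  Monoid.Coprod (Multiplicative (ZMod 2)) (Multiplicative (ZMod 2))

/-- The generator `a` of the first factor. -/
def genA : FreeProdZ2 := Monoid.Coprod.inl (Multiplicative.ofAdd 1)

/-- The generator `b` of the second factor. -/
def genB : FreeProdZ2 := Monoid.Coprod.inr (Multiplicative.ofAdd 1)

/-- The set `C_γ` of ordinary cusps of a closed front. -/
def cuspSet {X : Type*} [NormedAddCommGroup X] [NormedSpace ℝ X] (γ : ℝ → X) : Set ℝ :=
  {t | t ∈ Set.Ico (0 : ℝ) 1 ∧ IsOrdinaryCusp γ t}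

open Classical in
/-- The ordinary cusps in increasing order (if there are finitely many). -/
noncomputable def cuspList {X : Type*} [NormedAddCommGroup X] [NormedSpace ℝ X]
    (γ : ℝ → X) : List ℝ :=
  if h : (cuspSet γ).Finite then h.toFinset.sort (· ≤ ·) else []

open Classical in
/-- The letter of a cusp: `a` for a zig (`[η, η'] > 0`), `b` for a zag (`[η, η'] < 0`). -/
noncomputable def cuspLetter {X : Type*} [NormedAddCommGroup X] [NormedSpace ℝ X]
    (σ : LinearMap.BilinForm ℝ X) (η : ℝ → X) (t : ℝ) : FreeProdZ2 :=
  if 0 < σ (η t) (deriv η t) then genA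
  else if σ (η t) (deriv η t) < 0 then genB
  else 1

/-- The word `w_γ` of the cusps, as an element of `ℤ₂ * ℤ₂`. -/
noncomputable def cuspWord {X : Type*} [NormedAddCommGroup X] [NormedSpace ℝ X]
    (σ : LinearMap.BilinForm ℝ X) (γ η : ℝ → X) : FreeProdZ2 :=
  ((cuspList γ).map (cuspLetter σ η)).prod

/-- The Maslov index: the number `k` such that `w_γ` is `(ab)^k` or `(ba)^k`. -/
noncomputable def maslovIndex {X : Type*} [NormedAddCommGroup X] [NormedSpace ℝ X]
    (σ : LinearMap.BilinForm ℝ X) (γ η : ℝ → X) : ℕ :=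
  sInf {k : ℕ | cuspWord σ γ η = (genA * genB) ^ k ∨ cuspWord σ γ η = (genB * genA) ^ k}

/-! Inflection points, flips and flops -/

/-- `f` crosses zero at `t₀` from negative to positive. -/
def CrossesUp (f : ℝ → ℝ) (t₀ : ℝ) : Prop :=
  f t₀ = 0 ∧ (∀ᶠ t in 𝓝[<] t₀, f t < 0) ∧ (∀ᶠ t in 𝓝[>] t₀, 0 < f t)

/-- `f` crosses zero at `t₀` from positive to negative. -/
def CrossesDown (f : ℝ → ℝ) (t₀ : ℝ) : Prop :=
  f t₀ = 0 ∧ (∀ᶠ t in 𝓝[<] t₀, 0 < f t) ∧ (∀ᶠ t in 𝓝[>] t₀, f t < 0)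

/-- An inflection point: a zero-crossing of `κ`. -/
def IsInflection {X : Type*} [NormedAddCommGroup X] [NormedSpace ℝ X]
    (σ : LinearMap.BilinForm ℝ X) (η : ℝ → X) (t : ℝ) : Prop :=
  CrossesUp (curvKappa σ η) t ∨ CrossesDown (curvKappa σ η) t

/-- A flip: an inflection point where `α κ` crosses zero from negative to positive. -/
def IsFlip {X : Type*} [NormedAddCommGroup X] [NormedSpace ℝ X]
    (σ : LinearMap.BilinForm ℝ X) (γ η : ℝ → X) (t : ℝ) : Prop :=
  IsInflection σ η t ∧ CrossesUp (fun s => curvAlpha σ γ η s * curvKappa σ η s) t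

/-- A flop: an inflection point where `α κ` crosses zero from positive to negative. -/
def IsFlop {X : Type*} [NormedAddCommGroup X] [NormedSpace ℝ X]
    (σ : LinearMap.BilinForm ℝ X) (γ η : ℝ → X) (t : ℝ) : Prop :=
  IsInflection σ η t ∧ CrossesDown (fun s => curvAlpha σ γ η s * curvKappa σ η s) t

/-- The number of flips on `S¹`. -/
noncomputable def numFlip {X : Type*} [NormedAddCommGroup X] [NormedSpace ℝ X]
    (σ : LinearMap.BilinForm ℝ X) (γ η : ℝ → X) : ℕ :=
  {t | t ∈ Set.Ico (0 : ℝ) 1 ∧ IsFlip σ γ η t}.ncard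

/-- The number of flops on `S¹`. -/
noncomputable def numFlop {X : Type*} [NormedAddCommGroup X] [NormedSpace ℝ X]
    (σ : LinearMap.BilinForm ℝ X) (γ η : ℝ → X) : ℕ :=
  {t | t ∈ Set.Ico (0 : ℝ) 1 ∧ IsFlop σ γ η t}.ncard

/-- `d` is the degree of the map `S¹ → P¹(ℝ)`, `t ↦ [x t : y t]` (for `1`-periodic `x`, `y`
without common zeros): `t ↦ [x t : y t]` lifts to a continuous `θ : ℝ → ℝ` through the covering
`ℝ → P¹(ℝ)`, `θ ↦ [cos θ : sin θ]`, which has period `π`, and `θ` makes `d` turns over `P¹(ℝ)`.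
The orientation of `P¹(ℝ)` is the one in which the coordinate `y / x = tan θ` increases. -/
def HasProjDegree (x y : ℝ → ℝ) (d : ℤ) : Prop :=
  ∃ θ : ℝ → ℝ, Continuous θ ∧
    (∀ t, ∃ c : ℝ, c ≠ 0 ∧ x t = c * Real.cos (θ t) ∧ y t = c * Real.sin (θ t)) ∧
    ∀ t, θ (t + 1) = θ t + d * Real.pi

/-! The map `b` and the curvature functions are well defined -/

/-- Under smoothness, the vectors to which `v` is orthogonal form the kernel of `D‖·‖` at `v`. -/
theorem birkhoffOrthogonal_iff_fderiv {X : Type*} [NormedAddCommGroup X] [NormedSpace ℝ X]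
    (hsm : IsSmoothNorm X) {v : X} (hv : v ≠ 0) (w : X) :
    BirkhoffOrthogonal v w ↔ fderiv ℝ (fun y : X => ‖y‖) v w = 0 := by
  have hd := (hsm v hv).hasFDerivAt
  have hline : ∀ u : X, HasDerivAt (fun t : ℝ => ‖v + t • u‖)
      (fderiv ℝ (fun y : X => ‖y‖) v u) 0 := by
    intro u
    have h1 : HasDerivAt (fun t : ℝ => v + t • u) u 0 := by
      simpa using ((hasDerivAt_id (0 : ℝ)).smul_const u).const_add v
    have hd' : HasFDerivAt (fun y : X => ‖y‖) (fderiv ℝ (fun y : X => ‖y‖) v)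
        (v + (0 : ℝ) • u) := by simpa using hd
    exact hd'.comp_hasDerivAt (0 : ℝ) h1
  constructor
  · intro h
    have hmin : IsLocalMin (fun t : ℝ => ‖v + t • w‖) 0 :=
      Filter.Eventually.of_forall fun t => by simpa using h t
    exact hmin.hasDerivAt_eq_zero (hline w)
  · intro h t
    have hvv : fderiv ℝ (fun y : X => ‖y‖) v v = ‖v‖ := by
      have h2 : HasDerivAt (fun t : ℝ => (1 + t) * ‖v‖) ‖v‖ 0 := by
        simpa using ((hasDerivAt_id (0 : ℝ)).const_add 1).mul_const ‖v‖
      refine (hline v).unique (h2.congr_of_eventuallyEq ?_)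
      filter_upwards [lt_mem_nhds (show (-1 : ℝ) < 0 by norm_num)] with s hs
      have : v + s • v = (1 + s) • v := by rw [add_smul, one_smul]
      rw [this, norm_smul, Real.norm_of_nonneg (by linarith)]
    have hle : ‖fderiv ℝ (fun y : X => ‖y‖) v‖ ≤ 1 := by
      have := norm_fderiv_le_of_lipschitz (𝕜 := ℝ) (x₀ := v) (lipschitzWith_one_norm (E := X))
      simpa using this
    calc ‖v‖ = fderiv ℝ (fun y : X => ‖y‖) v (v + t • w) := by simp [h, hvv]
      _ ≤ ‖fderiv ℝ (fun y : X => ‖y‖) v (v + t • w)‖ := Real.le_norm_self _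
      _ ≤ ‖fderiv ℝ (fun y : X => ‖y‖) v‖ * ‖v + t • w‖ := ContinuousLinearMap.le_opNorm _ _
      _ ≤ 1 * ‖v + t • w‖ := by gcongr
      _ = ‖v + t • w‖ := one_mul _

/-- In a smooth normed plane, the vectors to which `v ≠ 0` is orthogonal are the multiples of a
unit vector `w` with `[v, w] > 0`. -/
theorem exists_tangent_line {X : Type*} [NormedAddCommGroup X] [NormedSpace ℝ X]
    (hdim : Module.finrank ℝ X = 2) (hsm : IsSmoothNorm X)
    (σ : LinearMap.BilinForm ℝ X) (halt : σ.IsAlt) (hσ : σ.Nondegenerate)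
    {v : X} (hv : v ≠ 0) :
    ∃ w : X, (‖w‖ = 1 ∧ 0 < σ v w) ∧
      ∀ u : X, BirkhoffOrthogonal v u ↔ ∃ c : ℝ, u = c • w := by
  have hfd : FiniteDimensional ℝ X := FiniteDimensional.of_finrank_pos (by omega)
  set L : X →ₗ[ℝ] ℝ := (fderiv ℝ (fun y : X => ‖y‖) v : X →L[ℝ] ℝ).toLinearMap with hL
  have horth : ∀ u, BirkhoffOrthogonal v u ↔ L u = 0 := birkhoffOrthogonal_iff_fderiv hsm hv
  have hLv : L v ≠ 0 := by
    intro h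
    have := (horth v).2 h (-1)
    simp at this
    exact hv this
  have hsurj : LinearMap.range L = ⊤ := by
    rw [LinearMap.range_eq_top]
    exact LinearMap.surjective (by intro h; exact hLv (by rw [h]; rfl))
  have hker : Module.finrank ℝ (LinearMap.ker L) = 1 := by
    have := LinearMap.finrank_range_add_finrank_ker L
    rw [hsurj, finrank_top, Module.finrank_self, hdim] at this
    omega
  obtain ⟨⟨u, hu⟩, hu0, hspan⟩ := finrank_eq_one_iff'.1 hker
  have hu0' : u ≠ 0 := fun h => hu0 (Subtype.ext h)
  have hspan' : ∀ x : X, L x = 0 → ∃ c : ℝ, c • u = x := by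
    intro x hx
    obtain ⟨c, hc⟩ := hspan ⟨x, hx⟩
    exact ⟨c, congrArg Subtype.val hc⟩
  have hLu : L u = 0 := hu
  have hσu : σ v u ≠ 0 := by
    intro h
    apply hv
    apply hσ.1
    intro x
    obtain ⟨c, hc⟩ := hspan' (x - (L x / L v) • v) (by simp [hLv])
    have hx : x = c • u + (L x / L v) • v := by rw [hc]; abel
    rw [hx]
    simp [h, halt v]
  have key : ∀ s : ℝ, s ≠ 0 → 0 < s * σ v u → ‖s • u‖ = 1 →
      ∃ w : X, (‖w‖ = 1 ∧ 0 < σ v w) ∧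
        ∀ x : X, BirkhoffOrthogonal v x ↔ ∃ c : ℝ, x = c • w := by
    intro s hs hpos hn
    refine ⟨s • u, ⟨hn, by simpa using hpos⟩, fun x => (horth x).trans ⟨fun hx => ?_, ?_⟩⟩
    · obtain ⟨c, hc⟩ := hspan' x hx
      refine ⟨c * s⁻¹, ?_⟩
      rw [smul_smul, mul_assoc, inv_mul_cancel₀ hs, mul_one, hc]
    · rintro ⟨c, rfl⟩
      simp [hLu]
  have hnu : ‖u‖ ≠ 0 := norm_ne_zero_iff.2 hu0'
  have hnu' : 0 < ‖u‖ := norm_pos_iff.2 hu0'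
  rcases lt_or_gt_of_ne hσu with h | h
  · refine key (-‖u‖⁻¹) (by simpa using hu0') ?_ ?_
    · have := inv_pos.2 hnu'
      nlinarith
    · rw [norm_smul, norm_neg, norm_inv, norm_norm, inv_mul_cancel₀ hnu]
  · refine key (‖u‖⁻¹) (by simpa using hu0') (mul_pos (inv_pos.2 hnu') h) ?_
    rw [norm_smul, norm_inv, norm_norm, inv_mul_cancel₀ hnu]

theorem existsUnique_tangentDir {X : Type*} [NormedAddCommGroup X] [NormedSpace ℝ X]
    (hdim : Module.finrank ℝ X = 2) (hsm : IsSmoothNorm X)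
    (σ : LinearMap.BilinForm ℝ X) (halt : σ.IsAlt) (hσ : σ.Nondegenerate)
    {v : X} (hv : v ≠ 0) :
    ∃! w : X, ‖w‖ = 1 ∧ BirkhoffOrthogonal v w ∧ 0 < σ v w := by
  obtain ⟨w, ⟨hw1, hw2⟩, hw⟩ := exists_tangent_line hdim hsm σ halt hσ hv
  refine ⟨w, ⟨hw1, (hw w).2 ⟨1, by simp⟩, hw2⟩, ?_⟩
  rintro x ⟨hx1, hx2, hx3⟩
  obtain ⟨c, rfl⟩ := (hw x).1 hx2
  have hc : 0 < c := by
    by_contra hc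
    have : σ v (c • w) = c * σ v w := by simp
    nlinarith
  rw [norm_smul, hw1, mul_one, Real.norm_of_nonneg hc.le] at hx1
  rw [hx1, one_smul]

theorem tangentDir_spec {X : Type*} [NormedAddCommGroup X] [NormedSpace ℝ X]
    (hdim : Module.finrank ℝ X = 2) (hsm : IsSmoothNorm X)
    (σ : LinearMap.BilinForm ℝ X) (halt : σ.IsAlt) (hσ : σ.Nondegenerate)
    {v : X} (hv : v ≠ 0) :
    ‖tangentDir σ v‖ = 1 ∧ BirkhoffOrthogonal v (tangentDir σ v) ∧ 0 < σ v (tangentDir σ v) :=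
  Classical.epsilon_spec (existsUnique_tangentDir hdim hsm σ halt hσ hv).exists

/-- A vector `u` with `v ⊣ u` is the multiple `([v, u] / [v, b v]) b v` of `b v`. -/
theorem eq_smul_tangentDir {X : Type*} [NormedAddCommGroup X] [NormedSpace ℝ X]
    (hdim : Module.finrank ℝ X = 2) (hsm : IsSmoothNorm X)
    (σ : LinearMap.BilinForm ℝ X) (halt : σ.IsAlt) (hσ : σ.Nondegenerate)
    {v u : X} (hv : v ≠ 0) (hu : BirkhoffOrthogonal v u) :
    u = (σ v u / σ v (tangentDir σ v)) • tangentDir σ v := by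
  obtain ⟨w, ⟨hw1, hw2⟩, hw⟩ := exists_tangent_line hdim hsm σ halt hσ hv
  have hwb : w = tangentDir σ v :=
    (existsUnique_tangentDir hdim hsm σ halt hσ hv).unique
      ⟨hw1, (hw w).2 ⟨1, by simp⟩, hw2⟩ (tangentDir_spec hdim hsm σ halt hσ hv)
  obtain ⟨c, rfl⟩ := (hw u).1 hu
  rw [← hwb]
  congr 1
  rw [map_smul, smul_eq_mul, mul_div_cancel_right₀ _ hw2.ne']

/-- `γ' = α ξ`. -/
theorem deriv_curve_eq {X : Type*} [NormedAddCommGroup X] [NormedSpace ℝ X]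
    (hdim : Module.finrank ℝ X = 2) (hsm : IsSmoothNorm X)
    (σ : LinearMap.BilinForm ℝ X) (halt : σ.IsAlt) (hσ : σ.Nondegenerate)
    {γ η : ℝ → X} (h : IsLegendreCurve γ η) (t : ℝ) :
    deriv γ t = curvAlpha σ γ η t • tangentDir σ (η t) :=
  eq_smul_tangentDir hdim hsm σ halt hσ
    (norm_ne_zero_iff.1 (by rw [h.norm_normal t]; exact one_ne_zero)) (h.orthogonal t)

/-- `η' = κ ξ`. -/
theorem deriv_normal_eq {X : Type*} [NormedAddCommGroup X] [NormedSpace ℝ X]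
    (hdim : Module.finrank ℝ X = 2) (hsm : IsSmoothNorm X)
    (σ : LinearMap.BilinForm ℝ X) (halt : σ.IsAlt) (hσ : σ.Nondegenerate)
    {γ η : ℝ → X} (h : IsLegendreCurve γ η) (t : ℝ) :
    deriv η t = curvKappa σ η t • tangentDir σ (η t) := by
  have hv : η t ≠ 0 := norm_ne_zero_iff.1 (by rw [h.norm_normal t]; exact one_ne_zero)
  refine eq_smul_tangentDir hdim hsm σ halt hσ hv
    ((birkhoffOrthogonal_iff_fderiv hsm hv _).2 ?_)
  have h1 : HasDerivAt η (deriv η t) t :=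
    (h.smooth_normal.differentiable (by simp) t).hasDerivAt
  have h2 : HasDerivAt (fun s => ‖η s‖) (fderiv ℝ (fun y : X => ‖y‖) (η t) (deriv η t)) t :=
    (hsm _ hv).hasFDerivAt.comp_hasDerivAt t h1
  have h3 : (fun s => ‖η s‖) = fun _ => (1 : ℝ) := funext h.norm_normal
  rw [h3] at h2
  exact h2.unique (hasDerivAt_const t 1)

/-! With A = [η, γ'] and K = [η, η'], the pair (A, K) is a closed path in the punctured plane: the
immersion condition forbids common zeros. Since A and K are α and κ times the same positive
function, [α : κ] = [A : K], and zero crossings are unchanged. Let w be the winding number of (A,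
K), obtained from the polar lift `exists_polar_lift`. Everything is computed from w.

The degree of [A : K] is 2w, because the angle on the projective line has period π
(`hasProjDegree_iff_of_polar`). The path crosses the axis K = 0 counterclockwise exactly when AK
goes from negative to positive, so flips minus flops is also 2w
(`two_mul_winding_eq_flip_sub_flop`).

Cusps are the zeros of A, all simple because γ'' ≠ 0 there (`deriv_bilinForm_ne_zero`); a zig
crosses the positive K half-axis, a zag the negative one. A path turning steadily reads alternating
letters, and a path that turns back reads the same letter twice in a row, which cancels as a² = b² =
1. Hence the word is (ab)^w or (ba)^w (`word_of_polar`). As ab has infinite order, the Maslov index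
is |w|.

Both counts are instances of `floor_transport`: cut the angle line into cells between consecutive
multiples of π, and follow a monoid-valued function of the cell along the lifted path. Only sign
changes matter, so the path may touch a wall, or stay on it for a while, without affecting the
count. -/

/-! ### Polar lift and winding number. -/

/-- Polar coordinates along a closed path in the punctured plane. -/
theorem exists_polar_lift {A K : ℝ → ℝ} (hA : ContDiff ℝ 1 A) (hK : ContDiff ℝ 1 K)
    (h : ∀ t, A t = 0 → K t ≠ 0) (pA : Function.Periodic A 1) (pK : Function.Periodic K 1) :
    ∃ r θ : ℝ → ℝ, (∀ t, 0 < r t) ∧ Continuous θ ∧ (∀ t, A t = r t * Real.cos (θ t)) ∧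
      (∀ t, K t = r t * Real.sin (θ t)) ∧ ∃ w : ℤ, ∀ t, θ (t + 1) = θ t + w * (2 * Real.pi) := by
  set z : ℝ → ℂ := fun t => A t + K t * Complex.I with hz
  have z0 : ∀ t, z t ≠ 0 := by
    intro t ht
    have h1 := congrArg Complex.re ht
    have h2 := congrArg Complex.im ht
    simp only [hz, Complex.add_re, Complex.ofReal_re, Complex.mul_re, Complex.I_re, mul_zero,
      Complex.ofReal_im, Complex.I_im, mul_one, sub_self, add_zero, Complex.zero_re,
      Complex.add_im, Complex.mul_im, zero_add, Complex.zero_im] at h1 h2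
    exact h t h1 h2
  have pz : Function.Periodic z 1 := fun t => by simp only [hz, pA t, pK t]
  have cz : ContDiff ℝ 1 z :=
    (Complex.ofRealCLM.contDiff.comp hA).add ((Complex.ofRealCLM.contDiff.comp hK).mul contDiff_const)
  have dz : ∀ t, HasDerivAt z (deriv z t) t := fun t =>
    (cz.differentiable (by simp) t).hasDerivAt
  -- The lift is a primitive J of the logarithmic derivative z'/z: the product z · exp(-J) is
  -- constant, so z = z(0) · exp J.
  set q : ℝ → ℂ := fun t => deriv z t / z t with hq
  have cq : Continuous q := (cz.continuous_deriv le_rfl).div cz.continuous z0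
  have pq : Function.Periodic q 1 := by
    intro t
    have : deriv z (t + 1) = deriv z t := by rw [← deriv_comp_add_const, funext pz]
    simp only [hq, pz t, this]
  set J : ℝ → ℂ := fun t => ∫ s in (0 : ℝ)..t, q s with hJ
  have dJ : ∀ t, HasDerivAt J (q t) t := fun t =>
    intervalIntegral.integral_hasDerivAt_right (cq.intervalIntegrable _ _)
      (cq.stronglyMeasurableAtFilter _ _) cq.continuousAt
  have cJ : Continuous J := continuous_iff_continuousAt.2 fun t => (dJ t).continuousAt
  have hconst : ∀ t, z t * Complex.exp (-J t) = z 0 := by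
    have hd : ∀ t, HasDerivAt (fun t => z t * Complex.exp (-J t)) 0 t := by
      intro t
      refine ((dz t).mul (dJ t).neg.cexp).congr_deriv ?_
      have hqz : q t * z t = deriv z t := div_mul_cancel₀ _ (z0 t)
      rw [← hqz, Pi.neg_apply]
      ring
    intro t
    have := is_const_of_deriv_eq_zero (fun t => (hd t).differentiableAt) (fun t => (hd t).deriv) t 0
    simpa [hJ] using this
  have hexp : ∀ t, z t = ‖z 0‖ * Complex.exp (J t + (z 0).arg * Complex.I) := by
    intro t
    rw [Complex.exp_add, mul_left_comm, Complex.norm_mul_exp_arg_mul_I, ← hconst t,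
      Complex.exp_neg]
    field_simp
  have hJ1 : ∀ t, J (t + 1) = J t + J 1 := by
    intro t
    have h1 := pq.intervalIntegral_add_eq t 0
    rw [zero_add] at h1
    simp only [hJ]
    rw [← h1, intervalIntegral.integral_add_adjacent_intervals] <;>
      exact cq.intervalIntegrable _ _
  -- Periodicity z(1) = z(0) forces exp (J 1) = 1, which gives the winding number.
  obtain ⟨w, hw⟩ : ∃ w : ℤ, J 1 = w * (2 * Real.pi * Complex.I) := by
    rw [← Complex.exp_eq_one_iff]
    have h1 := hconst 1
    have h2 := pz 0
    rw [zero_add] at h2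
    rw [h2, Complex.exp_neg] at h1
    field_simp [z0 0] at h1
    exact h1.symm
  refine ⟨fun t => ‖z 0‖ * Real.exp (J t).re, fun t => (J t).im + (z 0).arg, fun t => ?_,
    by fun_prop, fun t => ?_, fun t => ?_, w, fun t => ?_⟩
  · have := norm_pos_iff.2 (z0 0)
    positivity
  · have := congrArg Complex.re (hexp t)
    simpa [hz, Complex.exp_re, mul_assoc] using this
  · have := congrArg Complex.im (hexp t)
    simpa [hz, Complex.exp_im, mul_assoc] using this
  · simp only [hJ1, hw, Complex.add_im]
    simp
    ring

/-! ### Cells between consecutive multiples of π. -/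

/-- `sin` has opposite signs on the adjacent cells `(n π, (n + 1) π)` and
`((n + 1) π, (n + 2) π)`. -/
theorem sin_mul_sin_neg {n : ℤ} {x y : ℝ} (hx : n * Real.pi < x) (hx' : x < (n + 1) * Real.pi)
    (hy : (n + 1) * Real.pi < y) (hy' : y < (n + 2) * Real.pi) :
    Real.sin x * Real.sin y < 0 := by
  have h1 : 0 < Real.sin (x - n * Real.pi) :=
    Real.sin_pos_of_pos_of_lt_pi (by linarith) (by linarith)
  have h2 : 0 < Real.sin (y - (n + 1 : ℤ) * Real.pi) :=
    Real.sin_pos_of_pos_of_lt_pi (by push_cast; linarith) (by push_cast; linarith)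
  rw [Real.sin_sub_int_mul_pi] at h1 h2
  rw [zpow_add_one₀ (by norm_num)] at h2
  rcases Int.even_or_odd n with hn | hn
  · rw [hn.neg_one_zpow] at h1 h2; nlinarith
  · rw [hn.neg_one_zpow] at h1 h2; nlinarith

theorem cell_of_sin_ne_zero {x : ℝ} (hx : Real.sin x ≠ 0) :
    ⌊x / Real.pi⌋ * Real.pi < x ∧ x < (⌊x / Real.pi⌋ + 1) * Real.pi := by
  have h1 := Int.floor_le (x / Real.pi)
  have h2 := Int.lt_floor_add_one (x / Real.pi)
  rw [le_div_iff₀ Real.pi_pos] at h1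
  rw [div_lt_iff₀ Real.pi_pos] at h2
  refine ⟨lt_of_le_of_ne h1 fun h => hx ?_, h2⟩
  rw [← h, Real.sin_int_mul_pi]

theorem floor_div_pi_eq {x : ℝ} {n : ℤ} (h1 : n * Real.pi ≤ x) (h2 : x < (n + 1) * Real.pi) :
    ⌊x / Real.pi⌋ = n := by
  rw [Int.floor_eq_iff, le_div_iff₀ Real.pi_pos, div_lt_iff₀ Real.pi_pos]
  exact ⟨h1, h2⟩

/-- By the intermediate value theorem, a path that ends in another cell takes a value in the
interior of a cell adjacent to the initial one, where the sine has the opposite sign. The inequality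
is weak, so touching a wall is allowed. -/
theorem floor_eq_of_no_sign_change {φ : ℝ → ℝ} (hφ : Continuous φ) {u v : ℝ} (huv : u ≤ v)
    (hu : Real.sin (φ u) ≠ 0) (hv : Real.sin (φ v) ≠ 0)
    (h : ∀ t, u < t → t ≤ v → 0 ≤ Real.sin (φ u) * Real.sin (φ t)) :
    ⌊φ v / Real.pi⌋ = ⌊φ u / Real.pi⌋ := by
  obtain ⟨hu1, hu2⟩ := cell_of_sin_ne_zero hu
  set n := ⌊φ u / Real.pi⌋
  have hpi := Real.pi_pos
  have hit : ∀ y, y ∈ Set.uIcc (φ u) (φ v) → Real.sin (φ u) * Real.sin y < 0 → False := by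
    intro y hy hneg
    obtain ⟨t, ht, rfl⟩ := intermediate_value_uIcc hφ.continuousOn hy
    rw [Set.uIcc_of_le huv] at ht
    rcases eq_or_lt_of_le ht.1 with rfl | hlt
    · nlinarith
    · exact (h t hlt ht.2).not_gt hneg
  refine floor_div_pi_eq ?_ ?_
  · by_contra! hlt
    -- The maximum keeps y both among the values taken by φ and inside the cell n - 1.
    obtain ⟨y, hy1, hy2⟩ := exists_between
      (max_lt hlt (show (n - 1) * Real.pi < n * Real.pi by nlinarith))
    refine hit y ?_ ?_
    · rw [Set.uIcc_of_ge (by linarith)]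
      exact ⟨(le_max_left _ _).trans hy1.le, by linarith⟩
    · rw [mul_comm]
      have := (le_max_right _ _).trans_lt hy1
      refine sin_mul_sin_neg (n := n - 1) ?_ ?_ ?_ ?_ <;> push_cast <;> linarith
  · by_contra! hle
    have hlt : (n + 1) * Real.pi < φ v := by
      refine lt_of_le_of_ne hle fun he => hv ?_
      rw [← he]
      exact_mod_cast Real.sin_int_mul_pi (n + 1)
    obtain ⟨y, hy1, hy2⟩ := exists_between
      (lt_min hlt (show (n + 1) * Real.pi < (n + 2) * Real.pi by nlinarith))
    refine hit y ?_ ?_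
    · rw [Set.uIcc_of_le (by linarith)]
      exact ⟨by linarith, hy2.le.trans (min_le_left _ _)⟩
    · exact sin_mul_sin_neg hu1 hu2 hy1 (hy2.trans_le (min_le_right _ _))

/-- A function `T` of the cell changes, along a path, by the product of its changes at
the finitely many crossings of the walls `ℤ π`. -/
theorem floor_transport {M : Type*} [Monoid M] (T : ℤ → M) (L : ℝ → M) {φ : ℝ → ℝ}
    (hφ : Continuous φ) {v : ℝ} (hv : Real.sin (φ v) ≠ 0) (l : List ℝ) (hl : l.Pairwise (· < ·))
    (hloc : ∀ p ∈ l, ∀ᶠ s in 𝓝[<] p, ∀ᶠ t in 𝓝[>] p, Real.sin (φ s) ≠ 0 ∧ Real.sin (φ t) ≠ 0 ∧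
      T ⌊φ t / Real.pi⌋ = T ⌊φ s / Real.pi⌋ * L p) :
    ∀ u, u ≤ v → Real.sin (φ u) ≠ 0 → (∀ p ∈ l, p ∈ Set.Ioo u v) →
      (∀ s t, u ≤ s → s < t → t ≤ v → Real.sin (φ s) * Real.sin (φ t) < 0 →
        ∃ p ∈ l, p ∈ Set.Ioo s t) →
      T ⌊φ v / Real.pi⌋ = T ⌊φ u / Real.pi⌋ * (l.map L).prod := by
  induction l with
  | nil =>
    intro u huv hu _ hs
    rw [floor_eq_of_no_sign_change hφ huv hu hv]
    · simp
    · intro t h1 h2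
      by_contra! h
      obtain ⟨p, hp, _⟩ := hs u t le_rfl h1 h2 h
      simp at hp
  | cons c l ih =>
    intro u huv hu hmem hs
    rw [List.pairwise_cons] at hl
    have huc := hmem c (by simp)
    -- Bracket the first crossing c by s and t, with t before all later crossings: the cell is
    -- constant on [u, s], the local hypothesis takes s to t, and induction takes t to v.
    obtain ⟨s, hs1, hs2⟩ := ((hloc c (by simp)).and (Ioo_mem_nhdsLT huc.1)).exists
    have hnext : ∀ᶠ t in 𝓝[>] c, ∀ p ∈ l, t < p := by
      refine (List.finite_toSet l).eventually_all.2 fun p hp => ?_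
      filter_upwards [Ioo_mem_nhdsGT (hl.1 p hp)] with t ht using ht.2
    obtain ⟨t, ⟨⟨hs0, ht0, hT⟩, ht1⟩, ht2⟩ :=
      ((hs1.and (Ioo_mem_nhdsGT huc.2)).and hnext).exists
    have hsu : ⌊φ s / Real.pi⌋ = ⌊φ u / Real.pi⌋ := by
      refine floor_eq_of_no_sign_change hφ hs2.1.le hu hs0 fun x h1 h2 => ?_
      by_contra! h
      obtain ⟨p, hp, hp'⟩ := hs u x le_rfl h1 (by linarith [hs2.2, huc.2]) h
      rcases List.mem_cons.1 hp with rfl | hp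
      · linarith [hp'.2, hs2.2]
      · linarith [hp'.2, hs2.2, hl.1 p hp]
    rw [ih hl.2 (fun p hp => hloc p (by simp [hp])) t ht1.2.le ht0
      (fun p hp => ⟨ht2 p hp, (hmem p (by simp [hp])).2⟩) ?_, hT, hsu]
    · simp [mul_assoc]
    · intro a b h1 h2 h3 h4
      obtain ⟨p, hp, hp'⟩ := hs a b (by linarith [ht1.1, huc.1]) h2 h3 h4
      rcases List.mem_cons.1 hp with rfl | hp
      · linarith [hp'.1, ht1.1]
      · exact ⟨p, hp, hp'⟩

/-- Near a wall `m π`, the sign of `sin` determines the cell. -/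
theorem eventually_floor_eq {φ : ℝ → ℝ} (hφ : Continuous φ) {p : ℝ} {m : ℤ}
    (hp : φ p = m * Real.pi) :
    ∀ᶠ t in 𝓝 p, (0 < (-1 : ℝ) ^ m * Real.sin (φ t) → ⌊φ t / Real.pi⌋ = m) ∧
      ((-1 : ℝ) ^ m * Real.sin (φ t) < 0 → ⌊φ t / Real.pi⌋ = m - 1) := by
  have hpi := Real.pi_pos
  have h1 : ∀ᶠ t in 𝓝 p, φ t < (m + 1) * Real.pi :=
    hφ.continuousAt.eventually_lt_const (by rw [hp]; nlinarith)
  have h2 : ∀ᶠ t in 𝓝 p, (m - 1) * Real.pi < φ t :=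
    hφ.continuousAt.eventually_const_lt (by rw [hp]; nlinarith)
  filter_upwards [h1, h2] with t h1 h2
  rw [← Real.sin_sub_int_mul_pi]
  constructor <;> intro h
  · refine floor_div_pi_eq ?_ h1
    by_contra! hlt
    exact (Real.sin_neg_of_neg_of_neg_pi_lt (by linarith) (by linarith)).not_gt h
  · refine floor_div_pi_eq (by push_cast; linarith) ?_
    push_cast
    by_contra! hlt
    exact (Real.sin_nonneg_of_nonneg_of_le_pi (by linarith) (by linarith)).not_gt h

/-! The free product -/

theorem genA_mul_self : genA * genA = 1 := by
  rw [genA, ← map_mul, ← ofAdd_add, show (1 : ZMod 2) + 1 = 0 by decide, ofAdd_zero, map_one]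

theorem genB_mul_self : genB * genB = 1 := by
  rw [genB, ← map_mul, ← ofAdd_add, show (1 : ZMod 2) + 1 = 0 by decide, ofAdd_zero, map_one]

/-- The homomorphism `ℤ₂ → G` given by an involution. -/
def involutionHom {G : Type*} [Group G] (g : G) (hg : g * g = 1) : Multiplicative (ZMod 2) →* G :=
  MonoidHom.mk' (fun x => if x.toAdd = 0 then 1 else g) fun x y => by
    have h2 : ∀ x : ZMod 2, x = 0 ∨ x = 1 := by decide
    have h11 : (1 : ZMod 2) + 1 = 0 := by decide
    simp only [toAdd_mul]
    rcases h2 x.toAdd with hx | hx <;> rcases h2 y.toAdd with hy | hy <;>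
      simp [hx, hy, hg, h11]

/-- The target is the infinite dihedral group; two reflections whose product is the unit translation
detect that ab has infinite order. -/
theorem exists_dihedral_hom : ∃ f : FreeProdZ2 →* DihedralGroup 0,
    f (genA * genB) = DihedralGroup.r 1 ∧ f (genB * genA) = DihedralGroup.r (-1) := by
  refine ⟨Monoid.Coprod.lift (involutionHom (DihedralGroup.sr 0) (by simp))
    (involutionHom (DihedralGroup.sr 1) (by simp)), ?_, ?_⟩ <;>
  simp [genA, genB, involutionHom]

theorem genB_mul_genA_zpow (w : ℤ) : (genB * genA) ^ w = (genA * genB) ^ (-w) := by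
  have : genB * genA = (genA * genB)⁻¹ := by
    rw [mul_inv_rev, inv_eq_of_mul_eq_one_left genA_mul_self,
      inv_eq_of_mul_eq_one_left genB_mul_self]
  rw [this, inv_zpow, zpow_neg]

theorem genA_mul_genB_zpow_injective : Function.Injective fun w : ℤ => (genA * genB) ^ w := by
  obtain ⟨f, hf, -⟩ := exists_dihedral_hom
  intro v w h
  have := congrArg f h
  simp only [map_zpow, hf, DihedralGroup.r_one_zpow, DihedralGroup.r.injEq] at this
  exact this

/-- Since ba is the inverse of ab and the powers of ab are distinct, only the sign of the exponent
is ambiguous. This is the existence and uniqueness of the Maslov index. -/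
theorem eq_pow_iff_natAbs {x : FreeProdZ2} {w : ℤ}
    (hx : x = (genA * genB) ^ w ∨ x = (genB * genA) ^ w) (k : ℕ) :
    (x = (genA * genB) ^ k ∨ x = (genB * genA) ^ k) ↔ k = w.natAbs := by
  have h1 : ∀ m n : ℤ, (genA * genB) ^ m = (genA * genB) ^ n ↔ m = n := fun m n =>
    genA_mul_genB_zpow_injective.eq_iff
  rw [← zpow_natCast, ← zpow_natCast, genB_mul_genA_zpow]
  rw [genB_mul_genA_zpow] at hx
  rcases hx with rfl | rfl <;> rw [h1, h1] <;> omega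

/-- The words read off along a path in the universal cover: going from the cell `n` to the
adjacent cell across an odd (even) wall contributes the letter `a` (`b`). -/
def wordCell (n : ℤ) : FreeProdZ2 := (genA * genB) ^ (n / 2) * if Even n then 1 else genA

theorem wordCell_two_mul (k : ℤ) : wordCell (2 * k) = (genA * genB) ^ k := by
  simp [wordCell]

theorem wordCell_two_mul_add_one (k : ℤ) : wordCell (2 * k + 1) = (genA * genB) ^ k * genA := by
  rw [wordCell, if_neg (by simp), show (2 * k + 1) / 2 = k by omega]

theorem wordCell_even {m : ℤ} (hm : Even m) : wordCell m = wordCell (m - 1) * genB := by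
  obtain ⟨k, rfl⟩ := hm.exists_two_nsmul
  rw [show (2 • k - 1 : ℤ) = 2 * (k - 1) + 1 by simp; ring, nsmul_eq_mul, Nat.cast_ofNat,
    wordCell_two_mul, wordCell_two_mul_add_one, mul_assoc, ← zpow_add_one, sub_add_cancel]

theorem wordCell_odd {m : ℤ} (hm : Odd m) : wordCell m = wordCell (m - 1) * genA := by
  obtain ⟨k, rfl⟩ := hm
  rw [add_sub_cancel_right, wordCell_two_mul, wordCell_two_mul_add_one]

/-- The two alternatives reflect the parity of the starting cell: from an odd cell the word is
conjugated by a, which turns ab into ba. -/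
theorem eq_zpow_of_wordCell {n w : ℤ} {x : FreeProdZ2}
    (h : wordCell (n + 2 * w) = wordCell n * x) :
    x = (genA * genB) ^ w ∨ x = (genB * genA) ^ w := by
  rcases Int.even_or_odd' n with ⟨k, rfl | rfl⟩
  · left
    rw [← mul_add, wordCell_two_mul, wordCell_two_mul, zpow_add] at h
    exact (mul_left_cancel h).symm
  · right
    rw [show 2 * k + 1 + 2 * w = 2 * (k + w) + 1 by ring, wordCell_two_mul_add_one,
      wordCell_two_mul_add_one, zpow_add, mul_assoc, mul_assoc] at h
    have h := mul_left_cancel h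
    have hA : genA⁻¹ = genA := inv_eq_of_mul_eq_one_left genA_mul_self
    have : genB * genA = genA * (genA * genB) * genA⁻¹ := by
      rw [← mul_assoc, genA_mul_self, one_mul, hA]
    rw [this, conj_zpow, hA, mul_assoc, h, ← mul_assoc, genA_mul_self, one_mul]

/-! Zero crossings -/

theorem crossesDown_iff_neg {f : ℝ → ℝ} {p : ℝ} :
    CrossesDown f p ↔ CrossesUp (fun t => -f t) p := by
  simp [CrossesDown, CrossesUp]

theorem crossesUp_iff_neg {f : ℝ → ℝ} {p : ℝ} :
    CrossesUp f p ↔ CrossesDown (fun t => -f t) p := by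
  simp [CrossesDown, CrossesUp]

/-- Only the sign of the factor c matters, not its continuity. This allows α and κ to be replaced by
the pairings [η, γ'] and [η, η']. -/
theorem CrossesUp.of_pos_mul {f g c : ℝ → ℝ} {p : ℝ}
    (h : ∀ᶠ t in 𝓝 p, 0 < c t ∧ f t = c t * g t) (hf : CrossesUp f p) : CrossesUp g p := by
  obtain ⟨h0, hl, hr⟩ := hf
  refine ⟨?_, ?_, ?_⟩
  · obtain ⟨h1, h2⟩ := h.self_of_nhds
    rw [h0] at h2
    exact (mul_eq_zero.1 h2.symm).resolve_left h1.ne'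
  · filter_upwards [hl, h.filter_mono nhdsWithin_le_nhds] with t h1 h2
    rw [h2.2] at h1
    exact neg_of_mul_neg_right h1 h2.1.le
  · filter_upwards [hr, h.filter_mono nhdsWithin_le_nhds] with t h1 h2
    rw [h2.2] at h1
    exact pos_of_mul_pos_right h1 h2.1.le

theorem CrossesDown.of_pos_mul {f g c : ℝ → ℝ} {p : ℝ}
    (h : ∀ᶠ t in 𝓝 p, 0 < c t ∧ f t = c t * g t) (hf : CrossesDown f p) : CrossesDown g p := by
  rw [crossesDown_iff_neg] at hf ⊢
  refine hf.of_pos_mul (c := c) ?_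
  filter_upwards [h] with t ht
  exact ⟨ht.1, by rw [ht.2, mul_neg]⟩

theorem eventually_pos_mul_symm {f g c : ℝ → ℝ} {p : ℝ}
    (h : ∀ᶠ t in 𝓝 p, 0 < c t ∧ f t = c t * g t) :
    ∀ᶠ t in 𝓝 p, 0 < (c t)⁻¹ ∧ g t = (c t)⁻¹ * f t := by
  filter_upwards [h] with t ht
  exact ⟨inv_pos.2 ht.1, by rw [ht.2, inv_mul_cancel_left₀ ht.1.ne']⟩

theorem crossesUp_congr_pos_mul {f g c : ℝ → ℝ} {p : ℝ}
    (h : ∀ᶠ t in 𝓝 p, 0 < c t ∧ f t = c t * g t) : CrossesUp f p ↔ CrossesUp g p :=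
  ⟨fun hf => hf.of_pos_mul h, fun hg => hg.of_pos_mul (eventually_pos_mul_symm h)⟩

theorem crossesDown_congr_pos_mul {f g c : ℝ → ℝ} {p : ℝ}
    (h : ∀ᶠ t in 𝓝 p, 0 < c t ∧ f t = c t * g t) : CrossesDown f p ↔ CrossesDown g p :=
  ⟨fun hf => hf.of_pos_mul h, fun hg => hg.of_pos_mul (eventually_pos_mul_symm h)⟩

theorem CrossesUp.not_crossesDown {f : ℝ → ℝ} {p : ℝ} (h : CrossesUp f p) : ¬CrossesDown f p := by
  intro h'
  obtain ⟨t, h1, h2⟩ := (h.2.1.and h'.2.1).exists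
  exact h1.not_gt h2

/-- Multiplying by a continuous function without zero at `p` preserves zero crossings, up to the
direction. -/
theorem crosses_mul {A K : ℝ → ℝ} {p : ℝ} (hA : ContinuousAt A p) (h0 : A p ≠ 0)
    (h : CrossesUp K p ∨ CrossesDown K p) :
    CrossesUp (fun t => A t * K t) p ∨ CrossesDown (fun t => A t * K t) p := by
  rcases lt_or_gt_of_ne h0 with hneg | hpos
  · have h1 : ∀ᶠ t in 𝓝 p, 0 < -A t ∧ -(A t * K t) = -A t * K t := by
      filter_upwards [hA.eventually_lt_const hneg] with t ht
      exact ⟨neg_pos.2 ht, by ring⟩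
    rw [crossesDown_iff_neg, crossesUp_iff_neg, crossesUp_congr_pos_mul h1,
      crossesDown_congr_pos_mul h1]
    exact h.symm
  · have h1 : ∀ᶠ t in 𝓝 p, 0 < A t ∧ A t * K t = A t * K t := by
      filter_upwards [hA.eventually_const_lt hpos] with t ht
      exact ⟨ht, rfl⟩
    rwa [crossesUp_congr_pos_mul h1, crossesDown_congr_pos_mul h1]

theorem crosses_of_deriv_ne_zero {f : ℝ → ℝ} {p : ℝ} (h0 : f p = 0) (hd : deriv f p ≠ 0) :
    CrossesUp f p ∨ CrossesDown f p := by
  have key : ∀ g : ℝ → ℝ, g p = 0 → 0 < deriv g p → CrossesUp g p := by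
    intro g hg hpos
    have h1 := eventually_nhdsWithin_sign_eq_of_deriv_pos hpos hg
    refine ⟨hg, ?_, ?_⟩
    · filter_upwards [h1.filter_mono nhdsWithin_le_nhds, self_mem_nhdsWithin] with t h1 h2
      rw [sign_neg (sub_neg.2 h2)] at h1
      exact sign_eq_neg_one_iff.1 h1
    · filter_upwards [h1.filter_mono nhdsWithin_le_nhds, self_mem_nhdsWithin] with t h1 h2
      rw [sign_pos (sub_pos.2 h2)] at h1
      exact sign_eq_one_iff.1 h1
  rcases lt_or_gt_of_ne hd with h | h
  · right
    rw [crossesDown_iff_neg]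
    refine key _ (by simp [h0]) ?_
    rw [deriv.fun_neg]
    linarith
  · exact Or.inl (key f h0 h)

theorem exists_zero_of_mul_neg {f : ℝ → ℝ} (hf : Continuous f) {s t : ℝ} (hst : s < t)
    (h : f s * f t < 0) : ∃ p ∈ Set.Ioo s t, f p = 0 := by
  have h0 : (0 : ℝ) ∈ Set.uIcc (f s) (f t) := by
    rw [Set.mem_uIcc]
    rcases mul_neg_iff.1 h with h | h
    · exact Or.inr ⟨h.2.le, h.1.le⟩
    · exact Or.inl ⟨h.1.le, h.2.le⟩
  obtain ⟨p, hp, hp0⟩ := intermediate_value_uIcc hf.continuousOn h0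
  rw [Set.uIcc_of_le hst.le] at hp
  refine ⟨p, ⟨lt_of_le_of_ne hp.1 ?_, lt_of_le_of_ne hp.2 ?_⟩, hp0⟩
  · rintro rfl
    simp [hp0] at h
  · rintro rfl
    simp [hp0] at h

/-- Crossing the wall `m π` upward. -/
theorem floor_of_crossesUp {φ : ℝ → ℝ} (hφ : Continuous φ) {p : ℝ} {m : ℤ}
    (hp : φ p = m * Real.pi) (h : CrossesUp (fun t => (-1 : ℝ) ^ m * Real.sin (φ t)) p) :
    (∀ᶠ t in 𝓝[<] p, Real.sin (φ t) ≠ 0 ∧ ⌊φ t / Real.pi⌋ = m - 1) ∧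
      ∀ᶠ t in 𝓝[>] p, Real.sin (φ t) ≠ 0 ∧ ⌊φ t / Real.pi⌋ = m := by
  have h1 := eventually_floor_eq hφ hp
  constructor
  · filter_upwards [h1.filter_mono nhdsWithin_le_nhds, h.2.1] with t h1 h2
    exact ⟨right_ne_zero_of_mul h2.ne, h1.2 h2⟩
  · filter_upwards [h1.filter_mono nhdsWithin_le_nhds, h.2.2] with t h1 h2
    exact ⟨right_ne_zero_of_mul h2.ne', h1.1 h2⟩

/-- Crossing the wall `m π` downward. -/
theorem floor_of_crossesDown {φ : ℝ → ℝ} (hφ : Continuous φ) {p : ℝ} {m : ℤ}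
    (hp : φ p = m * Real.pi) (h : CrossesDown (fun t => (-1 : ℝ) ^ m * Real.sin (φ t)) p) :
    (∀ᶠ t in 𝓝[<] p, Real.sin (φ t) ≠ 0 ∧ ⌊φ t / Real.pi⌋ = m) ∧
      ∀ᶠ t in 𝓝[>] p, Real.sin (φ t) ≠ 0 ∧ ⌊φ t / Real.pi⌋ = m - 1 := by
  have h1 := eventually_floor_eq hφ hp
  constructor
  · filter_upwards [h1.filter_mono nhdsWithin_le_nhds, h.2.1] with t h1 h2
    exact ⟨right_ne_zero_of_mul h2.ne', h1.1 h2⟩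
  · filter_upwards [h1.filter_mono nhdsWithin_le_nhds, h.2.2] with t h1 h2
    exact ⟨right_ne_zero_of_mul h2.ne, h1.2 h2⟩

/-- A continuous function with values in the discrete set πℤ is constant, by the intermediate value
theorem. -/
theorem eq_of_sin_eq_zero {δ : ℝ → ℝ} (hδ : Continuous δ) (h : ∀ t, Real.sin (δ t) = 0)
    (s t : ℝ) : δ s = δ t := by
  have key : ∀ s t, ¬δ s < δ t := by
    intro s t hst
    obtain ⟨y, hy1, hy2⟩ := exists_between
      (lt_min hst (show δ s < δ s + Real.pi by linarith [Real.pi_pos]))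
    obtain ⟨x, -, rfl⟩ := intermediate_value_uIcc (a := s) (b := t) hδ.continuousOn
      (Set.mem_uIcc.2 (Or.inl ⟨hy1.le, hy2.le.trans (min_le_left _ _)⟩))
    have := hy2.trans_le (min_le_right _ _)
    have h1 : 0 < Real.sin (δ x - δ s) :=
      Real.sin_pos_of_pos_of_lt_pi (by linarith) (by linarith)
    rw [Real.sin_sub, h, h] at h1
    simp at h1
  exact le_antisymm (not_lt.1 (key t s)) (not_lt.1 (key s t))

/-! ### The cusp word and the winding number. -/

/-- The word of the simple zeros of `r cos θ` in a period, for a closed path of winding number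
`w`. -/
theorem word_of_polar {A K r θ : ℝ → ℝ} {w : ℤ} (hr : ∀ t, 0 < r t) (hθ : Continuous θ)
    (hA : ∀ t, A t = r t * Real.cos (θ t)) (hK : ∀ t, K t = r t * Real.sin (θ t))
    (hw : ∀ t, θ (t + 1) = θ t + w * (2 * Real.pi)) (cA : Continuous A)
    (pA : Function.Periodic A 1) (hsimple : ∀ t, A t = 0 → deriv A t ≠ 0)
    (l : List ℝ) (hl : l.Pairwise (· < ·)) (hmem : ∀ t, t ∈ l ↔ t ∈ Set.Ico (0 : ℝ) 1 ∧ A t = 0)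
    (L : ℝ → FreeProdZ2) (hLa : ∀ t ∈ l, 0 < K t → L t = genA)
    (hLb : ∀ t ∈ l, K t < 0 → L t = genB) :
    (l.map L).prod = (genA * genB) ^ w ∨ (l.map L).prod = (genB * genA) ^ w := by
  -- A quarter turn moves the zeros of A = r cos θ to the walls φ ∈ πℤ.
  set φ : ℝ → ℝ := fun t => θ t + Real.pi / 2 with hφ
  have cφ : Continuous φ := by fun_prop
  have hAφ : ∀ t, A t = r t * Real.sin (φ t) := fun t => by
    rw [hA, hφ, Real.sin_add_pi_div_two]
  have hKφ : ∀ t, K t = -(r t * Real.cos (φ t)) := fun t => by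
    rw [hK, hφ, Real.cos_add_pi_div_two]; ring
  have hne : ∀ t, A t ≠ 0 → Real.sin (φ t) ≠ 0 := fun t h => by
    rw [hAφ] at h; exact right_ne_zero_of_mul h
  -- The base point must lie off the walls, but 0 may itself be a cusp. Starting slightly before 0,
  -- with no zero in [u, 0), the period from u to u + 1 meets the same zeros in the same order as
  -- [0, 1), so the word is not cyclically rotated.
  obtain ⟨u, hu1, hu0, hu⟩ : ∃ u : ℝ, -1 < u ∧ u < 0 ∧ ∀ t, u ≤ t → t < 0 → A t ≠ 0 := by
    have h0 : ∀ᶠ t in 𝓝[<] (0 : ℝ), A t ≠ 0 := by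
      by_cases h : A 0 = 0
      · rcases crosses_of_deriv_ne_zero h (hsimple 0 h) with h | h
        · exact h.2.1.mono fun t ht => ht.ne
        · exact h.2.1.mono fun t ht => ht.ne'
      · exact (cA.continuousAt.eventually_ne h).filter_mono nhdsWithin_le_nhds
    obtain ⟨a, ha, hsub⟩ := mem_nhdsLT_iff_exists_Ioo_subset.1 h0
    rw [Set.mem_Iio] at ha
    obtain ⟨u, h1, h2⟩ := exists_between (max_lt ha (show (-1 : ℝ) < 0 by norm_num))
    exact ⟨u, (le_max_right _ _).trans_lt h1, h2, fun t h3 h4 =>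
      hsub ⟨((le_max_left _ _).trans_lt h1).trans_le h3, h4⟩⟩
  have hsu := hne u (hu u le_rfl hu0)
  have hsv : Real.sin (φ (u + 1)) ≠ 0 := hne _ (by rw [pA]; exact hu u le_rfl hu0)
  have key := floor_transport wordCell L cφ hsv l hl ?_ u (by linarith) hsu ?_ ?_
  · refine eq_zpow_of_wordCell (n := ⌊φ u / Real.pi⌋) ?_
    rw [← key]
    congr 1
    rw [← Int.floor_add_intCast]
    congr 1
    simp only [hφ, hw]
    push_cast
    field_simp
    ring
  · intro p hp
    have hA0 := ((hmem p).1 hp).2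
    obtain ⟨m, hm⟩ : ∃ m : ℤ, φ p = m * Real.pi := by
      have : Real.sin (φ p) = 0 := by
        have := hAφ p
        rw [hA0] at this
        exact (mul_eq_zero.1 this.symm).resolve_left (hr p).ne'
      obtain ⟨m, hm⟩ := Real.sin_eq_zero_iff.1 this
      exact ⟨m, hm.symm⟩
    -- On the wall mπ the sign of K is opposite to that of (-1)^m, so odd walls carry a and even
    -- walls carry b, as `wordCell` requires.
    have hKp : K p = -(r p * (-1 : ℝ) ^ m) := by rw [hKφ, hm, Real.cos_int_mul_pi]
    have hsq : L p * L p = 1 ∧ wordCell m = wordCell (m - 1) * L p := by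
      rcases Int.even_or_odd m with h | h
      · rw [hLb p hp (by rw [hKp, h.neg_one_zpow]; linarith [hr p])]
        exact ⟨genB_mul_self, wordCell_even h⟩
      · rw [hLa p hp (by rw [hKp, h.neg_one_zpow]; linarith [hr p])]
        exact ⟨genA_mul_self, wordCell_odd h⟩
    -- As letters are involutions, crossing the wall backward contributes the same letter as
    -- crossing it forward.
    have hback : wordCell (m - 1) = wordCell m * L p := by rw [hsq.2, mul_assoc, hsq.1, mul_one]
    have hcr : CrossesUp (fun t => (-1 : ℝ) ^ m * Real.sin (φ t)) p ∨
        CrossesDown (fun t => (-1 : ℝ) ^ m * Real.sin (φ t)) p := by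
      refine crosses_mul continuousAt_const (zpow_ne_zero _ (by norm_num)) ?_
      have hc : ∀ᶠ t in 𝓝 p, 0 < r t ∧ A t = r t * Real.sin (φ t) :=
        .of_forall fun t => ⟨hr t, hAφ t⟩
      rw [← crossesUp_congr_pos_mul hc, ← crossesDown_congr_pos_mul hc]
      exact crosses_of_deriv_ne_zero hA0 (hsimple p hA0)
    rcases hcr with h | h
    · obtain ⟨h1, h2⟩ := floor_of_crossesUp cφ hm h
      filter_upwards [h1] with s hs
      filter_upwards [h2] with t ht
      exact ⟨hs.1, ht.1, by rw [hs.2, ht.2, hsq.2]⟩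
    · obtain ⟨h1, h2⟩ := floor_of_crossesDown cφ hm h
      filter_upwards [h1] with s hs
      filter_upwards [h2] with t ht
      exact ⟨hs.1, ht.1, by rw [hs.2, ht.2, hback]⟩
  · intro p hp
    obtain ⟨h1, h2⟩ := (hmem p).1 hp
    refine ⟨hu0.trans_le h1.1, ?_⟩
    by_contra! h
    refine hu (p - 1) (by linarith) (by linarith [h1.2]) ?_
    rw [← pA, sub_add_cancel, h2]
  · intro s t h1 h2 h3 h4
    obtain ⟨p, hp, hp0⟩ := exists_zero_of_mul_neg (f := A) cA h2 (by
      rw [hAφ, hAφ]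
      have := mul_pos (hr s) (hr t)
      nlinarith)
    refine ⟨p, (hmem p).2 ⟨⟨?_, by linarith [hp.2]⟩, hp0⟩, hp⟩
    by_contra! h
    exact hu p (h1.trans hp.1.le) h hp0

/-- Simple zeros are isolated, whereas infinitely many zeros in the compact [0, 1] would accumulate.
-/
theorem finite_simple_zeros {A : ℝ → ℝ} (cA : Continuous A)
    (hsimple : ∀ t, A t = 0 → deriv A t ≠ 0) : {t | t ∈ Set.Ico (0 : ℝ) 1 ∧ A t = 0}.Finite := by
  have hiso : ∀ p, ∀ᶠ t in 𝓝[≠] p, A t ≠ 0 := by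
    intro p
    by_cases h : A p = 0
    · have hd := hsimple p h
      exact (differentiableAt_of_deriv_ne_zero hd).hasDerivAt.eventually_ne hd
    · exact (cA.continuousAt.eventually_ne h).filter_mono nhdsWithin_le_nhds
  refine Set.Finite.subset (s := Set.Icc (0 : ℝ) 1 ∩ {t | A t = 0}) ?_
    fun t ht => ⟨Set.Ico_subset_Icc_self ht.1, ht.2⟩
  by_contra hinf
  obtain ⟨x, -, hx⟩ := Set.Infinite.exists_accPt_of_subset_isCompact hinf isCompact_Icc
    Set.inter_subset_left
  rw [accPt_iff_frequently_nhdsNE] at hx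
  exact hx ((hiso x).mono fun t ht h => ht h.2)

/-! ### Periodic counting of flips and flops. -/

theorem CrossesUp.comp_add {f : ℝ → ℝ} {t a : ℝ} (h : CrossesUp f (t + a)) :
    CrossesUp (fun s => f (s + a)) t := by
  have hc : Filter.Tendsto (fun s => s + a) (𝓝 t) (𝓝 (t + a)) :=
    (continuous_add_const a).tendsto t
  refine ⟨h.1, ?_, ?_⟩
  · exact (tendsto_nhdsWithin_iff.2 ⟨hc.mono_left nhdsWithin_le_nhds,
      eventually_nhdsWithin_of_forall fun s (hs : s < t) => add_lt_add_left hs a⟩).eventually h.2.1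
  · exact (tendsto_nhdsWithin_iff.2 ⟨hc.mono_left nhdsWithin_le_nhds,
      eventually_nhdsWithin_of_forall fun s (hs : t < s) => add_lt_add_left hs a⟩).eventually h.2.2

theorem crossesUp_add_one {f : ℝ → ℝ} (hf : Function.Periodic f 1) (t : ℝ) :
    CrossesUp f (t + 1) ↔ CrossesUp f t := by
  constructor
  · intro h
    have := h.comp_add
    rwa [funext hf] at this
  · intro h
    have : CrossesUp (fun s => f (s + -1)) (t + 1) :=
      CrossesUp.comp_add (by rwa [add_neg_cancel_right])
    convert this using 2 with s
    rw [← hf (s + -1), neg_add_cancel_right]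

theorem crossesDown_add_one {f : ℝ → ℝ} (hf : Function.Periodic f 1) (t : ℝ) :
    CrossesDown f (t + 1) ↔ CrossesDown f t := by
  rw [crossesDown_iff_neg, crossesDown_iff_neg]
  exact crossesUp_add_one (fun s => by simp only [hf s]) t

/-- Points of `ℝ/ℤ` may be counted in any period. -/
theorem image_toIcoMod_Ico {P : ℝ → Prop} (hP : ∀ t, P (t + 1) ↔ P t) (a b : ℝ) :
    toIcoMod one_pos b '' {t | t ∈ Set.Ico a (a + 1) ∧ P t} =
      {t | t ∈ Set.Ico b (b + 1) ∧ P t} := by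
  have hP' : ∀ (n : ℤ) t, P (t + n) ↔ P t := by
    intro n t
    have : Function.Periodic P 1 := fun t => propext (hP t)
    have := this.int_mul n t
    rw [mul_one] at this
    rw [this]
  have hmod : ∀ c t, P (toIcoMod one_pos c t) ↔ P t := by
    intro c t
    conv_rhs => rw [← toIcoMod_add_toIcoDiv_zsmul one_pos c t, zsmul_one]
    rw [hP']
  ext t
  constructor
  · rintro ⟨s, ⟨hs, hPs⟩, rfl⟩
    exact ⟨toIcoMod_mem_Ico one_pos b s, (hmod b s).2 hPs⟩
  · rintro ⟨ht, hPt⟩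
    refine ⟨toIcoMod one_pos a t, ⟨toIcoMod_mem_Ico one_pos a t, (hmod a t).2 hPt⟩, ?_⟩
    rw [toIcoMod_toIcoMod]
    exact (toIcoMod_eq_self one_pos).2 ht

/-- Reduction modulo 1 is a bijection between the two period windows. It allows the base point to be
moved to a place where K does not vanish. -/
theorem ncard_Ico_periodic {P : ℝ → Prop} (hP : ∀ t, P (t + 1) ↔ P t) (a b : ℝ) :
    {t | t ∈ Set.Ico a (a + 1) ∧ P t}.ncard = {t | t ∈ Set.Ico b (b + 1) ∧ P t}.ncard := by
  rw [← image_toIcoMod_Ico hP a b, Set.InjOn.ncard_image]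
  rintro s ⟨hs, -⟩ t ⟨ht, -⟩ h
  have := congrArg (toIcoMod one_pos a) h
  rwa [toIcoMod_toIcoMod, toIcoMod_toIcoMod, (toIcoMod_eq_self one_pos).2 hs,
    (toIcoMod_eq_self one_pos).2 ht] at this

theorem two_mul_winding_eq_flip_sub_flop {A K r θ : ℝ → ℝ} {w : ℤ} (hr : ∀ t, 0 < r t)
    (hθ : Continuous θ) (hA : ∀ t, A t = r t * Real.cos (θ t))
    (hK : ∀ t, K t = r t * Real.sin (θ t)) (hw : ∀ t, θ (t + 1) = θ t + w * (2 * Real.pi))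
    (cA : Continuous A) (pA : Function.Periodic A 1) (pK : Function.Periodic K 1)
    (hfin : {t | t ∈ Set.Ico (0 : ℝ) 1 ∧ (CrossesUp K t ∨ CrossesDown K t)}.Finite)
    (hcross : ∀ s t, s < t → K s * K t < 0 →
      ∃ u ∈ Set.Ioo s t, CrossesUp K u ∨ CrossesDown K u) :
    2 * w = ({t | t ∈ Set.Ico (0 : ℝ) 1 ∧ (CrossesUp K t ∨ CrossesDown K t) ∧
        CrossesUp (fun s => A s * K s) t}.ncard : ℤ) -
      {t | t ∈ Set.Ico (0 : ℝ) 1 ∧ (CrossesUp K t ∨ CrossesDown K t) ∧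
        CrossesDown (fun s => A s * K s) t}.ncard := by
  classical
  -- If K vanishes identically, no base point lies off the walls; but then θ takes values in πℤ,
  -- hence is constant, and w = 0.
  by_cases hall : ∀ t, K t = 0
  · have hno : ∀ t, ¬(CrossesUp K t ∨ CrossesDown K t) := by
      rintro t (h | h)
      · obtain ⟨s, hs⟩ := h.2.1.exists
        exact hs.ne (hall s)
      · obtain ⟨s, hs⟩ := h.2.1.exists
        exact hs.ne' (hall s)
    have h1 := eq_of_sin_eq_zero hθ (fun t => by
      have := hK t
      rw [hall t] at this
      exact (mul_eq_zero.1 this.symm).resolve_left (hr t).ne') (0 + 1) 0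
    rw [hw] at h1
    have : (w : ℝ) = 0 := by
      have := Real.pi_pos
      have : (w : ℝ) * (2 * Real.pi) = 0 := by linarith
      exact (mul_eq_zero.1 this).resolve_right (by positivity)
    have hw0 : w = 0 := by exact_mod_cast this
    simp [hno, hw0]
  push Not at hall
  obtain ⟨u, hu⟩ := hall
  have pAK : Function.Periodic (fun s => A s * K s) 1 := fun s => by simp only [pA s, pK s]
  have hI : ∀ t, (CrossesUp K (t + 1) ∨ CrossesDown K (t + 1)) ↔
      (CrossesUp K t ∨ CrossesDown K t) := fun t => by
    rw [crossesUp_add_one pK, crossesDown_add_one pK]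
  have hS : {t | t ∈ Set.Ico u (u + 1) ∧ (CrossesUp K t ∨ CrossesDown K t)}.Finite := by
    rw [← image_toIcoMod_Ico hI 0 u, zero_add]
    exact hfin.image _
  set S := hS.toFinset with hSdef
  have hmem : ∀ t, t ∈ S ↔ t ∈ Set.Ico u (u + 1) ∧ (CrossesUp K t ∨ CrossesDown K t) := fun t => by
    rw [hSdef, Set.Finite.mem_toFinset, Set.mem_ofPred_eq]
  have hsin_zero : ∀ t, K t = 0 → Real.sin (θ t) = 0 := fun t h => by
    have := hK t
    rw [h] at this
    exact (mul_eq_zero.1 this.symm).resolve_left (hr t).ne'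
  have hsin : ∀ t, K t ≠ 0 → Real.sin (θ t) ≠ 0 := fun t h => by
    rw [hK] at h; exact right_ne_zero_of_mul h
  have hzero : ∀ {t}, CrossesUp K t ∨ CrossesDown K t → K t = 0 := fun h => h.elim (·.1) (·.1)
  have hAne : ∀ t, K t = 0 → A t ≠ 0 := by
    intro t h h'
    have h1 := Real.sin_sq_add_cos_sq (θ t)
    rw [hA] at h'
    rw [hsin_zero t h, (mul_eq_zero.1 h').resolve_left (hr t).ne'] at h1
    norm_num at h1
  have hdir : ∀ t, CrossesUp K t ∨ CrossesDown K t →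
      (CrossesUp (fun s => A s * K s) t ∨ CrossesDown (fun s => A s * K s) t) := fun t h =>
    crosses_mul cA.continuousAt (hAne t (hzero h)) h
  set ℓ : ℝ → ℤ := fun p => if CrossesUp (fun s => A s * K s) p then 1 else -1 with hℓ
  -- Here the transported function is the cell number itself, written multiplicatively; it grows by
  -- 2w over a period.
  have key := floor_transport (fun n : ℤ => Multiplicative.ofAdd n)
    (fun p => Multiplicative.ofAdd (ℓ p)) hθ (v := u + 1) (hsin _ (by rwa [pK])) (S.sort (· ≤ ·))
    (Finset.sortedLT_sort S).pairwise ?_ u (by linarith) (hsin _ hu) ?_ ?_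
  · have hprod : ((S.sort (· ≤ ·)).map fun p => Multiplicative.ofAdd (ℓ p)).prod =
        Multiplicative.ofAdd (∑ p ∈ S, ℓ p) := by
      rw [← List.prod_toFinset _ (Finset.sort_nodup S _), Finset.sort_toFinset, ofAdd_sum]
    have hfl : ⌊θ (u + 1) / Real.pi⌋ = ⌊θ u / Real.pi⌋ + 2 * w := by
      rw [← Int.floor_add_intCast]
      congr 1
      rw [hw]
      push_cast
      field_simp
    rw [hprod, hfl, ← ofAdd_add, Multiplicative.ofAdd.injective.eq_iff] at key
    have hsum : 2 * w = ∑ p ∈ S, ℓ p := by linarith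
    have c1 : {t | t ∈ Set.Ico (0 : ℝ) 1 ∧ (CrossesUp K t ∨ CrossesDown K t) ∧
        CrossesUp (fun s => A s * K s) t}.ncard =
        (S.filter fun t => CrossesUp (fun s => A s * K s) t).card := by
      have := ncard_Ico_periodic (P := fun t => (CrossesUp K t ∨ CrossesDown K t) ∧
        CrossesUp (fun s => A s * K s) t) (fun t => by rw [hI, crossesUp_add_one pAK]) 0 u
      rw [zero_add] at this
      rw [this, ← Set.ncard_coe_finset]
      congr 1
      ext t
      simp only [Finset.coe_filter, hmem, Set.mem_ofPred_eq, and_assoc]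
    have c2 : {t | t ∈ Set.Ico (0 : ℝ) 1 ∧ (CrossesUp K t ∨ CrossesDown K t) ∧
        CrossesDown (fun s => A s * K s) t}.ncard =
        (S.filter fun t => ¬CrossesUp (fun s => A s * K s) t).card := by
      have := ncard_Ico_periodic (P := fun t => (CrossesUp K t ∨ CrossesDown K t) ∧
        CrossesDown (fun s => A s * K s) t) (fun t => by rw [hI, crossesDown_add_one pAK]) 0 u
      rw [zero_add] at this
      rw [this, ← Set.ncard_coe_finset]
      congr 1
      ext t
      simp only [Finset.coe_filter, hmem, Set.mem_ofPred_eq, and_assoc]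
      refine and_congr_right fun _ => and_congr_right fun h => ⟨fun h1 h2 => h2.not_crossesDown h1,
        (hdir t h).resolve_left⟩
    rw [hsum, c1, c2, hℓ, Finset.sum_ite]
    simp
    ring
  · intro p hp
    rw [Finset.mem_sort, hmem] at hp
    have hK0 := hzero hp.2
    obtain ⟨m, hm⟩ := Real.sin_eq_zero_iff.1 (hsin_zero p hK0)
    -- Near the wall mπ, cos θ has the sign of (-1)^m, so AK is a positive multiple of (-1)^m sin θ.
    -- An upward crossing of AK therefore means that θ passes from cell m - 1 to cell m, whatever
    -- the parity of m.
    have hc : ∀ᶠ t in 𝓝 p, 0 < r t ^ 2 * ((-1 : ℝ) ^ m * Real.cos (θ t)) ∧ A t * K t =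
        r t ^ 2 * ((-1 : ℝ) ^ m * Real.cos (θ t)) * ((-1 : ℝ) ^ m * Real.sin (θ t)) := by
      have hsq : (-1 : ℝ) ^ m * (-1 : ℝ) ^ m = 1 := by
        rw [← mul_zpow]; norm_num
      have hcos : 0 < (-1 : ℝ) ^ m * Real.cos (θ p) := by
        rw [← hm, Real.cos_int_mul_pi, hsq]; exact one_pos
      have hcc : ContinuousAt (fun t => (-1 : ℝ) ^ m * Real.cos (θ t)) p := by fun_prop
      filter_upwards [hcc.eventually_const_lt hcos] with t ht
      refine ⟨mul_pos (pow_pos (hr t) 2) ht, ?_⟩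
      rw [hA, hK]
      linear_combination (-r t ^ 2 * Real.cos (θ t) * Real.sin (θ t)) * hsq
    by_cases h : CrossesUp (fun s => A s * K s) p
    · obtain ⟨h1, h2⟩ := floor_of_crossesUp hθ hm.symm (h.of_pos_mul hc)
      filter_upwards [h1] with s hs
      filter_upwards [h2] with t ht
      refine ⟨hs.1, ht.1, ?_⟩
      rw [hs.2, ht.2, ← ofAdd_add, hℓ]
      simp only [if_pos h]
      congr 1
      ring
    · obtain ⟨h1, h2⟩ := floor_of_crossesDown hθ hm.symm
        (((hdir p hp.2).resolve_left h).of_pos_mul hc)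
      filter_upwards [h1] with s hs
      filter_upwards [h2] with t ht
      refine ⟨hs.1, ht.1, ?_⟩
      rw [hs.2, ht.2, ← ofAdd_add, hℓ]
      simp only [if_neg h]
      congr 1
  · intro p hp
    rw [Finset.mem_sort, hmem] at hp
    refine ⟨lt_of_le_of_ne hp.1.1 ?_, hp.1.2⟩
    rintro rfl
    exact hu (hzero hp.2)
  · intro s t h1 h2 h3 h4
    obtain ⟨p, hp, hpc⟩ := hcross s t h2 (by
      rw [hK, hK]
      have := mul_pos (hr s) (hr t)
      nlinarith)
    refine ⟨p, ?_, hp⟩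
    rw [Finset.mem_sort, hmem]
    exact ⟨⟨h1.trans hp.1.le, hp.2.trans_le h3⟩, hpc⟩

/-! ### Degree of the map to the projective line. -/

/-- Two lifts of the same projective path differ by a continuous πℤ-valued function, hence by a
constant, so they have equal increments over a period. The polar angle is one such lift, with
increment 2πw. -/
theorem hasProjDegree_iff_of_polar {A K D r θ : ℝ → ℝ} {w : ℤ} (hr : ∀ t, 0 < r t)
    (hθ : Continuous θ) (hA : ∀ t, D t * A t = r t * Real.cos (θ t))
    (hK : ∀ t, D t * K t = r t * Real.sin (θ t))
    (hw : ∀ t, θ (t + 1) = θ t + w * (2 * Real.pi)) (hD : ∀ t, 0 < D t) (d : ℤ) :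
    HasProjDegree A K d ↔ d = 2 * w := by
  constructor
  · rintro ⟨θ', cθ', hc, hd⟩
    have hsin : ∀ t, Real.sin (θ' t - θ t) = 0 := by
      intro t
      obtain ⟨c, hc0, h1, h2⟩ := hc t
      have h3 : c * r t * Real.sin (θ' t - θ t) = 0 := by
        rw [Real.sin_sub]
        have e1 := hA t
        have e2 := hK t
        rw [h1] at e1
        rw [h2] at e2
        linear_combination (-c * Real.sin (θ' t)) * e1 + (c * Real.cos (θ' t)) * e2
      exact (mul_eq_zero.1 h3).resolve_left (mul_ne_zero hc0 (hr t).ne')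
    have h := eq_of_sin_eq_zero (cθ'.sub hθ) hsin (0 + 1) 0
    rw [Pi.sub_apply, Pi.sub_apply, hd, hw] at h
    have h4 : ((d : ℝ) - 2 * w) * Real.pi = 0 := by linarith
    have h5 := (mul_eq_zero.1 h4).resolve_right Real.pi_ne_zero
    rw [sub_eq_zero] at h5
    exact_mod_cast h5
  · rintro rfl
    refine ⟨θ, hθ, fun t => ⟨r t / D t, (div_pos (hr t) (hD t)).ne', ?_, ?_⟩, fun t => ?_⟩
    · rw [div_mul_eq_mul_div, ← hA, mul_div_cancel_left₀ _ (hD t).ne']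
    · rw [div_mul_eq_mul_div, ← hK, mul_div_cancel_left₀ _ (hD t).ne']
    · rw [hw]
      push_cast
      ring

/-! ### Cusps in the normed plane. -/

section NormedPlane

variable {X : Type*} [NormedAddCommGroup X] [NormedSpace ℝ X]

theorem BirkhoffOrthogonal.smul {x y : X} (h : BirkhoffOrthogonal x y) (c : ℝ) :
    BirkhoffOrthogonal x (c • y) := fun t => by
  rw [smul_smul]
  exact h _

/-- A bilinear form on a finite-dimensional space as a continuous bilinear map. -/
noncomputable def LinearMap.BilinForm.toContinuous [FiniteDimensional ℝ X]
    (σ : LinearMap.BilinForm ℝ X) : X →L[ℝ] X →L[ℝ] ℝ :=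
  LinearMap.toContinuousLinearMap
    ((LinearMap.toContinuousLinearMap : (X →ₗ[ℝ] ℝ) ≃ₗ[ℝ] (X →L[ℝ] ℝ)).toLinearMap ∘ₗ σ)

theorem contDiff_bilinForm [FiniteDimensional ℝ X] (σ : LinearMap.BilinForm ℝ X)
    {f g : ℝ → X} (hf : ContDiff ℝ 1 f) (hg : ContDiff ℝ 1 g) :
    ContDiff ℝ 1 fun t => σ (f t) (g t) :=
  (σ.toContinuous.contDiff.comp hf).clm_apply hg

theorem hasDerivAt_bilinForm [FiniteDimensional ℝ X] (σ : LinearMap.BilinForm ℝ X)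
    {f g : ℝ → X} {f' g' : X} {t : ℝ} (hf : HasDerivAt f f' t) (hg : HasDerivAt g g' t) :
    HasDerivAt (fun t => σ (f t) (g t)) (σ f' (g t) + σ (f t) g') t :=
  (σ.toContinuous.hasFDerivAt.comp_hasDerivAt t hf).clm_apply hg

theorem Function.Periodic.deriv_one {f : ℝ → X} (hf : Function.Periodic f 1) :
    Function.Periodic (deriv f) 1 := fun t => by
  rw [← deriv_comp_add_const, funext hf]

/-- At a singular point, the second derivative is still tangent. -/
theorem IsLegendreCurve.orthogonal_deriv_deriv {γ η : ℝ → X} (h : IsLegendreCurve γ η) {p : ℝ}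
    (hp : deriv γ p = 0) (hd : DifferentiableAt ℝ (deriv γ) p) :
    BirkhoffOrthogonal (η p) (deriv (deriv γ) p) := by
  intro c
  have h1 := hasDerivAt_iff_tendsto_slope.1 hd.hasDerivAt
  have h2 : Filter.Tendsto η (𝓝[≠] p) (𝓝 (η p)) :=
    h.smooth_normal.continuous.continuousAt.mono_left nhdsWithin_le_nhds
  -- Since γ'(p) = 0, the slopes of γ' at p are multiples of γ'(t), and the inequality defining
  -- orthogonality to them passes to the limit.
  refine le_of_tendsto_of_tendsto' h2.norm (h2.add (h1.const_smul c)).norm fun t => ?_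
  rw [slope_def_module, hp, sub_zero]
  exact (h.orthogonal t).smul _ c

/-- At a cusp the derivative of [η, γ'] reduces to [η, γ'']. As γ'' is a multiple of b(η), a zero
pairing would give γ'' = 0, against linear independence. -/
theorem deriv_bilinForm_ne_zero (hdim : Module.finrank ℝ X = 2) (hsm : IsSmoothNorm X)
    (σ : LinearMap.BilinForm ℝ X) (halt : σ.IsAlt) (hσ : σ.Nondegenerate)
    {γ η : ℝ → X} (h : IsLegendreCurve γ η) {p : ℝ} (hp : IsOrdinaryCusp γ p) :
    deriv (fun t => σ (η t) (deriv γ t)) p ≠ 0 := by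
  have hfd : FiniteDimensional ℝ X := FiniteDimensional.of_finrank_pos (by omega)
  have hγ' : Differentiable ℝ (deriv γ) :=
    (contDiff_infty_iff_deriv.1 h.smooth_curve).2.differentiable (by simp)
  have hη : Differentiable ℝ η := h.smooth_normal.differentiable (by simp)
  rw [(hasDerivAt_bilinForm σ (hη p).hasDerivAt (hγ' p).hasDerivAt).deriv, hp.1, map_zero,
    zero_add]
  intro h0
  have h2 := eq_smul_tangentDir hdim hsm σ halt hσ
    (norm_ne_zero_iff.1 (by rw [h.norm_normal p]; exact one_ne_zero))
    (h.orthogonal_deriv_deriv hp.1 (hγ' p))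
  rw [h0, zero_div, zero_smul] at h2
  have h3 := hp.2.ne_zero 0
  simp only [Matrix.cons_val_zero, iteratedDeriv_succ, iteratedDeriv_zero] at h3
  exact h3 h2

end NormedPlane

/-! ### The flip/flop formula. -/

theorem theorem4p2 {X : Type*} [NormedAddCommGroup X] [NormedSpace ℝ X] [StrictConvexSpace ℝ X]
    (hdim : Module.finrank ℝ X = 2) (hsm : IsSmoothNorm X)
    (σ : LinearMap.BilinForm ℝ X) (halt : σ.IsAlt) (hσ : σ.Nondegenerate)
    (γ η : ℝ → X) (hfront : IsClosedFront γ η) (hgen : IsGenericFront γ η)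
    -- the inflection points can be counted
    (hfin : {t | t ∈ Set.Ico (0 : ℝ) 1 ∧ IsInflection σ η t}.Finite)
    -- the sign of `κ` changes only at inflection points
    (hcross : ∀ s t : ℝ, s < t → curvKappa σ η s * curvKappa σ η t < 0 →
      ∃ u ∈ Set.Ioo s t, IsInflection σ η u) :
    -- every inflection point is either a flip or a flop
    (∀ t, IsInflection σ η t → Xor (IsFlip σ γ η t) (IsFlop σ γ η t)) ∧
    -- the Maslov index is well defined
    (cuspSet γ).Finite ∧
    (∀ k : ℕ, (cuspWord σ γ η = (genA * genB) ^ k ∨ cuspWord σ γ η = (genB * genA) ^ k) ↔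
      k = maslovIndex σ γ η) ∧
    -- the degree of `k_γ = [α : κ]` is the signed count of flips and flops
    (∀ d : ℤ, HasProjDegree (curvAlpha σ γ η) (curvKappa σ η) d ↔
      d = (numFlip σ γ η : ℤ) - (numFlop σ γ η : ℤ)) ∧
    -- the flip/flop formula
    (maslovIndex σ γ η : ℝ) = 1 / 2 * |(numFlip σ γ η : ℝ) - (numFlop σ γ η : ℝ)| := by
  have hfd : FiniteDimensional ℝ X := FiniteDimensional.of_finrank_pos (by omega)
  have hleg : IsLegendreCurve γ η := hfront.toIsLegendreCurve
  have hη0 : ∀ t, η t ≠ 0 := fun t =>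
    norm_ne_zero_iff.1 (by rw [hleg.norm_normal t]; exact one_ne_zero)
  -- The pairings A and K are C¹, being built from smooth maps and σ; α and κ also involve b, so
  -- their regularity is never needed. The normalizing factor D enters only through its positivity.
  set D : ℝ → ℝ := fun t => σ (η t) (tangentDir σ (η t)) with hDdef
  set A : ℝ → ℝ := fun t => σ (η t) (deriv γ t) with hAdef
  set K : ℝ → ℝ := fun t => σ (η t) (deriv η t) with hKdef
  have hD : ∀ t, 0 < D t := fun t => (tangentDir_spec hdim hsm σ halt hσ (hη0 t)).2.2
  have hDA : ∀ t, D t * curvAlpha σ γ η t = A t := fun t => mul_div_cancel₀ _ (hD t).ne'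
  have hDK : ∀ t, D t * curvKappa σ η t = K t := fun t => mul_div_cancel₀ _ (hD t).ne'
  have hη1 : ContDiff ℝ 1 η := hleg.smooth_normal.of_le (by simp)
  have hγ' : ContDiff ℝ 1 (deriv γ) :=
    (contDiff_infty_iff_deriv.1 hleg.smooth_curve).2.of_le (by simp)
  have hη' : ContDiff ℝ 1 (deriv η) :=
    (contDiff_infty_iff_deriv.1 hleg.smooth_normal).2.of_le (by simp)
  have cA : ContDiff ℝ 1 A := contDiff_bilinForm σ hη1 hγ'
  have cK : ContDiff ℝ 1 K := contDiff_bilinForm σ hη1 hη'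
  have pA : Function.Periodic A 1 := fun t => by
    simp only [hAdef, hfront.periodic_normal t, hfront.periodic_curve.deriv_one t]
  have pK : Function.Periodic K 1 := fun t => by
    simp only [hKdef, hfront.periodic_normal t, hfront.periodic_normal.deriv_one t]
  have hA0 : ∀ t, A t = 0 ↔ deriv γ t = 0 := by
    refine fun t => ⟨fun h => ?_, fun h => by simp only [hAdef, h, map_zero]⟩
    rw [deriv_curve_eq hdim hsm σ halt hσ hleg t, curvAlpha]
    exact (congrArg (fun x => (x / D t) • tangentDir σ (η t)) h).trans (by simp)
  have hK0 : ∀ t, K t = 0 → deriv η t = 0 := by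
    intro t h
    rw [deriv_normal_eq hdim hsm σ halt hσ hleg t, curvKappa]
    exact (congrArg (fun x => (x / D t) • tangentDir σ (η t)) h).trans (by simp)
  have hAK : ∀ t, A t = 0 → K t ≠ 0 := fun t h h' =>
    (hfront.immersion t).elim (fun hn => hn ((hA0 t).1 h)) fun hn => hn (hK0 t h')
  have hcusp : ∀ t, IsOrdinaryCusp γ t ↔ A t = 0 := fun t =>
    ⟨fun h => (hA0 t).2 h.1, fun h => hgen.singular_cusp t ((hA0 t).1 h)⟩
  have hsimple : ∀ t, A t = 0 → deriv A t ≠ 0 := fun t h =>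
    deriv_bilinForm_ne_zero hdim hsm σ halt hσ hleg ((hcusp t).2 h)
  have hinfl : ∀ t, IsInflection σ η t ↔ (CrossesUp K t ∨ CrossesDown K t) := by
    intro t
    have hc : ∀ᶠ s in 𝓝 t, 0 < D s ∧ K s = D s * curvKappa σ η s :=
      .of_forall fun s => ⟨hD s, (hDK s).symm⟩
    rw [IsInflection, crossesUp_congr_pos_mul hc, crossesDown_congr_pos_mul hc]
  have hprod : ∀ t, ∀ᶠ s in 𝓝 t, 0 < D s ^ 2 ∧
      A s * K s = D s ^ 2 * (curvAlpha σ γ η s * curvKappa σ η s) := fun t =>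
    .of_forall fun s => ⟨pow_pos (hD s) 2, by rw [← hDA, ← hDK]; ring⟩
  have hflip : ∀ t, IsFlip σ γ η t ↔ (CrossesUp K t ∨ CrossesDown K t) ∧
      CrossesUp (fun s => A s * K s) t := fun t => by
    rw [IsFlip, hinfl, crossesUp_congr_pos_mul (hprod t)]
  have hflop : ∀ t, IsFlop σ γ η t ↔ (CrossesUp K t ∨ CrossesDown K t) ∧
      CrossesDown (fun s => A s * K s) t := fun t => by
    rw [IsFlop, hinfl, crossesDown_congr_pos_mul (hprod t)]
  obtain ⟨r, θ, hr, cθ, hAr, hKr, w, hw⟩ := exists_polar_lift cA cK hAK pA pK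
  have hcount : 2 * w = (numFlip σ γ η : ℤ) - (numFlop σ γ η : ℤ) := by
    simp only [numFlip, numFlop, hflip, hflop]
    simp only [hinfl] at hfin hcross
    refine two_mul_winding_eq_flip_sub_flop hr cθ hAr hKr hw cA.continuous pA pK hfin
      fun s t hst h => hcross s t hst ?_
    rw [← hDK, ← hDK] at h
    have := mul_pos (hD s) (hD t)
    by_contra! h'
    nlinarith [mul_nonneg this.le h']
  have hset : cuspSet γ = {t | t ∈ Set.Ico (0 : ℝ) 1 ∧ A t = 0} := by
    simp only [cuspSet, hcusp]
  have hcfin : (cuspSet γ).Finite := hset ▸ finite_simple_zeros cA.continuous hsimple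
  have hmem : ∀ t, t ∈ cuspList γ ↔ t ∈ Set.Ico (0 : ℝ) 1 ∧ A t = 0 := fun t => by
    rw [cuspList, dif_pos hcfin, Finset.mem_sort, Set.Finite.mem_toFinset, hset]
    rfl
  have hsorted : (cuspList γ).Pairwise (· < ·) := by
    rw [cuspList, dif_pos hcfin]
    exact (Finset.sortedLT_sort _).pairwise
  have hword : cuspWord σ γ η = (genA * genB) ^ w ∨ cuspWord σ γ η = (genB * genA) ^ w :=
    word_of_polar hr cθ hAr hKr hw cA.continuous pA hsimple _ hsorted hmem _
      (fun t _ h => if_pos h) fun t _ h => (if_neg h.not_gt).trans (if_pos h)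
  have hmaslov : maslovIndex σ γ η = w.natAbs := by
    -- The set of admissible k is the singleton of |w|, so the infimum is attained there.
    simp only [maslovIndex, eq_pow_iff_natAbs hword]
    exact csInf_singleton _
  refine ⟨fun t ht => ?_, hcfin, fun k => ?_, fun d => ?_, ?_⟩
  · rw [hinfl] at ht
    have hA : A t ≠ 0 := fun h => hAK t h (ht.elim (·.1) (·.1))
    rw [hflip, hflop]
    rcases crosses_mul cA.continuous.continuousAt hA ht with h | h
    · exact Or.inl ⟨⟨ht, h⟩, fun h' => h.not_crossesDown h'.2⟩
    · exact Or.inr ⟨⟨ht, h⟩, fun h' => h'.2.not_crossesDown h⟩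
  · rw [hmaslov, eq_pow_iff_natAbs hword]
  · rw [← hcount]
    exact hasProjDegree_iff_of_polar hr cθ (fun t => (hDA t).trans (hAr t))
      (fun t => (hDK t).trans (hKr t)) hw hD d
  · have h2 : (numFlip σ γ η : ℝ) - (numFlop σ γ η : ℝ) = 2 * (w : ℝ) := by
      exact_mod_cast hcount.symm
    rw [hmaslov, h2, abs_mul, abs_two, Nat.cast_natAbs, Int.cast_abs]
    ring
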